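/- Let $n\ge 0$, and let $\mathcal F$ be a smooth foliation of codimension one of Euclidean space $\mathbb R^{n+1}$ each of whose leaves is an entire graph, that is, $L=\{(x,u(x)) : x\in\mathbb R^n\}$ for some smooth function $u:\mathbb R^n\to\mathbb R$. Let $N$ be the smooth unit vector field on $\mathbb R^{n+1}$ that is normal to the leaves and upward-pointing (its last component is positive). Assume that the second fundamental form of the leaves with respect to $N$ is nonnegative, that is, $\langle -\overline\nabla_v N, v\rangle\ge 0$ for every leaf $L$, every $p\in L$ and every $v\in T_pL$, where $\overline\nabla$ is the standard connection of $\mathbb R^{n+1}$. Assume further that $N$ converges at infinity to a fixed nonzero vector $\xi\in\mathbb R^{n+1}$, in the sense that the angle $\theta(p)\in[0,\pi]$ between $N(p)$ and $\xi$ tends to $0$ as $|p|\to\infty$ in $\mathbb R^{n+1}$. Then every leaf of $\mathcal F$ is a hyperplane orthogonal to $\xi$, i.e. of the form $\{p\in\mathbb R^{n+1} : \langle \xi,p\rangle=c\}$ with $c\in\mathbb R$. -/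

import Mathlib

open scoped ContDiff RealInnerProductSpace Topology

/-- Euclidean space `ℝ^n` with its standard inner product. -/
abbrev Euc (n : ℕ) : Type := EuclideanSpace ℝ (Fin n)

/-- A smooth foliation of codimension one of `ℝ^(n+1)`: a partition into path-connected leaves
such that around every point there is a smooth chart `φ : U → ℝ^n × ℝ` (a diffeomorphism onto an
open set) for which the connected components of `U ∩ L`, for every leaf `L`, are exactly
the slices `{last coordinate of φ = const}` of `U` that they meet. -/
structure Foliation (n : ℕ) where
  /-- the set of leaves -/
  leaves : Set (Set (Euc (n + 1)))
  isPartition : Setoid.IsPartition leaves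
  isPathConnected : ∀ L ∈ leaves, IsPathConnected L
  exists_foliatedChart : ∀ p : Euc (n + 1), ∃ φ : OpenPartialHomeomorph (Euc (n + 1)) (Euc n × ℝ),
    p ∈ φ.source ∧ ContDiffOn ℝ ∞ φ φ.source ∧ ContDiffOn ℝ ∞ φ.symm φ.target ∧
      ∀ L ∈ leaves, ∀ q ∈ φ.source ∩ L,
        connectedComponentIn (φ.source ∩ L) q = {x ∈ φ.source | (φ x).2 = (φ q).2}

/-- The orthogonal projection `ℝ^(n+1) → ℝ^n` that forgets the last coordinate. -/
def baseProj {n : ℕ} (p : Euc (n + 1)) : Euc n :=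
  WithLp.toLp 2 (fun i : Fin n => p i.castSucc)

/-- `L` is an entire graph: the graph `{(x, u x) : x ∈ ℝ^n}` of a smooth function `u` defined on
all of `ℝ^n`. -/
def IsEntireGraph {n : ℕ} (L : Set (Euc (n + 1))) : Prop :=
  ∃ u : Euc n → ℝ, ContDiff ℝ ∞ u ∧ L = {p | p (Fin.last n) = u (baseProj p)}

/-- The vectors tangent to `L` at `p`: velocities at `p` of smooth curves lying in `L`. -/
def tangentVectors {n : ℕ} (L : Set (Euc (n + 1))) (p : Euc (n + 1)) : Set (Euc (n + 1)) :=
  {v | ∃ γ : ℝ → Euc (n + 1), ContDiffAt ℝ ∞ γ 0 ∧ γ 0 = p ∧ deriv γ 0 = v ∧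
    ∀ᶠ t in 𝓝 (0 : ℝ), γ t ∈ L}

/-- `N` is the upward-pointing unit normal (smooth) vector field of the foliation. -/
structure IsUpwardUnitNormal {n : ℕ} (F : Foliation n) (N : Euc (n + 1) → Euc (n + 1)) : Prop where
  smooth : ContDiff ℝ ∞ N
  norm_eq_one : ∀ p, ‖N p‖ = 1
  normal : ∀ L ∈ F.leaves, ∀ p ∈ L, ∀ v ∈ tangentVectors L p, ⟪N p, v⟫ = 0
  upward : ∀ p, 0 < N p (Fin.last n)

/-- The operator `A Y = - ∇_Y N`; the Levi-Civita connection of `ℝ^(n+1)` is the ordinary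
directional derivative. -/
noncomputable def shapeOperator {n : ℕ} (N : Euc (n + 1) → Euc (n + 1)) (p : Euc (n + 1)) :
    Euc (n + 1) →L[ℝ] Euc (n + 1) :=
  -fderiv ℝ N p

/-- The second fundamental form of the leaves with respect to `N` is nonnegative:
`⟨A v, v⟩ ≥ 0` for every vector `v` tangent to a leaf. -/
def NonnegSecondFundamentalForm {n : ℕ} (F : Foliation n) (N : Euc (n + 1) → Euc (n + 1)) : Prop :=
  ∀ L ∈ F.leaves, ∀ p ∈ L, ∀ v ∈ tangentVectors L p, 0 ≤ ⟪shapeOperator N p v, v⟫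

/-- `N` converges to `ξ` at infinity: the angle between `N p` and `ξ` tends to `0` as `p` leaves
every compact subset of `ℝ^(n+1)`. -/
def ConvergesAtInfinity {n : ℕ} (N : Euc (n + 1) → Euc (n + 1)) (ξ : Euc (n + 1)) : Prop :=
  Filter.Tendsto (fun p => InnerProductGeometry.angle (N p) ξ)
    (Filter.cocompact (Euc (n + 1))) (𝓝 0)

/-- `L` is a hyperplane of `ℝ^(n+1)` orthogonal to (the nonzero vector) `ξ`. -/
def IsHyperplaneOrthogonalTo {n : ℕ} (L : Set (Euc (n + 1))) (ξ : Euc (n + 1)) : Prop :=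
  ξ ≠ 0 ∧ ∃ c : ℝ, L = {p | ⟪ξ, p⟫ = c}

/-! Fix a leaf and lift a line `t ↦ p + t w` vertically to it. Nonnegative curvature makes the
lifting height convex (`monotone_deriv_graphHeight`), and orthogonality to `N` gives its slope as
`-⟪N, w⟫ / N_last`. If `w` is not vertical, both ends of the lifted curve go to infinity, where `N`
has the same limit `ξ/‖ξ‖`. Once `ξ` is known not to be horizontal (`last_limit_normal_ne_zero`),
the monotone slope has equal limits at `±∞`, so it is constant; the curve then has velocity
orthogonal to `ξ`, and `⟪ξ, ·⟫` is constant on the leaf. -/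

/-- The vertical unit vector of `ℝ^(n+1)`. -/
noncomputable def vertical (n : ℕ) : Euc (n + 1) := EuclideanSpace.single (Fin.last n) 1

theorem inner_vertical {n : ℕ} (p : Euc (n + 1)) : ⟪p, vertical n⟫ = p (Fin.last n) := by
  simp [vertical, EuclideanSpace.inner_single_right]

theorem vertical_last (n : ℕ) : vertical n (Fin.last n) = 1 := by
  simp [vertical]

/-- The projection `baseProj` as a continuous linear map. -/
noncomputable def baseProjL (n : ℕ) : Euc (n + 1) →L[ℝ] Euc n :=
  LinearMap.toContinuousLinearMap
    { toFun := baseProj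
      map_add' := fun x y => by ext i; simp [baseProj]
      map_smul' := fun c x => by ext i; simp [baseProj] }

theorem baseProjL_apply {n : ℕ} (p : Euc (n + 1)) : baseProjL n p = baseProj p := rfl

theorem baseProjL_vertical (n : ℕ) : baseProjL n (vertical n) = 0 := by
  ext i
  simp [baseProjL_apply, baseProj, vertical, Fin.castSucc_ne_last]

theorem eq_of_baseProjL_eq_of_last_eq {n : ℕ} {p q : Euc (n + 1)}
    (h : baseProjL n p = baseProjL n q) (hl : p (Fin.last n) = q (Fin.last n)) : p = q := by
  ext i
  refine Fin.lastCases hl (fun j => ?_) i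
  simpa [baseProjL_apply, baseProj] using congrArg (fun z : Euc n => z j) h

/-- The height over the line `t ↦ p + t w` of the graph of `u`. -/
noncomputable def graphHeight {n : ℕ} (u : Euc n → ℝ) (p w : Euc (n + 1)) (t : ℝ) : ℝ :=
  u (baseProjL n (p + t • w)) - (p + t • w) (Fin.last n)

/-- The curve in the graph of `u` lying over the line `t ↦ p + t w`. -/
noncomputable def graphCurve {n : ℕ} (u : Euc n → ℝ) (p w : Euc (n + 1)) (t : ℝ) : Euc (n + 1) :=
  p + t • w + graphHeight u p w t • vertical n

theorem contDiff_graphHeight {n : ℕ} {u : Euc n → ℝ} (hu : ContDiff ℝ ∞ u) (p w : Euc (n + 1)) :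
    ContDiff ℝ ∞ (graphHeight u p w) := by
  have hline : ContDiff ℝ ∞ (fun t : ℝ => p + t • w) := by fun_prop
  have hlast : ContDiff ℝ ∞ (fun t : ℝ => (p + t • w) (Fin.last n)) := by
    simp only [← inner_vertical]
    exact hline.inner ℝ contDiff_const
  exact (hu.comp ((baseProjL n).contDiff.comp hline)).sub hlast

theorem contDiff_graphCurve {n : ℕ} {u : Euc n → ℝ} (hu : ContDiff ℝ ∞ u) (p w : Euc (n + 1)) :
    ContDiff ℝ ∞ (graphCurve u p w) := by
  have := contDiff_graphHeight hu p w
  unfold graphCurve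
  fun_prop

theorem hasDerivAt_graphCurve {n : ℕ} {u : Euc n → ℝ} (hu : ContDiff ℝ ∞ u) (p w : Euc (n + 1))
    (t : ℝ) :
    HasDerivAt (graphCurve u p w) (w + deriv (graphHeight u p w) t • vertical n) t := by
  have h := ((contDiff_graphHeight hu p w).differentiable (by simp) t).hasDerivAt
  have hline : HasDerivAt (fun s : ℝ => p + s • w) w t := by
    simpa using ((hasDerivAt_id t).smul_const w).const_add p
  exact hline.add (h.smul_const (vertical n))

theorem baseProjL_graphCurve {n : ℕ} (u : Euc n → ℝ) (p w : Euc (n + 1)) (t : ℝ) :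
    baseProjL n (graphCurve u p w t) = baseProjL n p + t • baseProjL n w := by
  simp [graphCurve, baseProjL_vertical]

theorem graphCurve_mem {n : ℕ} (u : Euc n → ℝ) (p w : Euc (n + 1)) (t : ℝ) :
    graphCurve u p w t ∈ {q : Euc (n + 1) | q (Fin.last n) = u (baseProj q)} := by
  have h := baseProjL_graphCurve u p w t
  rw [Set.mem_ofPred_eq, ← baseProjL_apply, h]
  simp [graphCurve, graphHeight, vertical_last]

theorem graphCurve_zero {n : ℕ} {u : Euc n → ℝ} {p : Euc (n + 1)}
    (hp : p (Fin.last n) = u (baseProj p)) (w : Euc (n + 1)) : graphCurve u p w 0 = p := by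
  simp [graphCurve, graphHeight, baseProjL_apply, hp]

theorem graphCurve_sub_one {n : ℕ} {u : Euc n → ℝ} (p : Euc (n + 1)) {q : Euc (n + 1)}
    (hq : q (Fin.last n) = u (baseProj q)) : graphCurve u p (q - p) 1 = q := by
  simp only [graphCurve, graphHeight, one_smul, add_sub_cancel, baseProjL_apply, hq, sub_self,
    zero_smul, add_zero]

/-- The projected curve is a nonconstant affine line, hence proper; a curve whose continuous
projection leaves every compact set does so itself. -/
theorem tendsto_graphCurve_cocompact {n : ℕ} (u : Euc n → ℝ) (p : Euc (n + 1)) {w : Euc (n + 1)}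
    (hw : baseProjL n w ≠ 0) :
    Filter.Tendsto (graphCurve u p w) (Filter.cocompact ℝ) (Filter.cocompact (Euc (n + 1))) := by
  have hline : Filter.Tendsto (fun t : ℝ => baseProjL n p + t • baseProjL n w)
      (Filter.cocompact ℝ) (Filter.cocompact (Euc n)) := by
    exact ((Homeomorph.addLeft (baseProjL n p)).isClosedEmbedding.comp
      (isClosedEmbedding_smul_left hw)).tendsto_cocompact
  have h : Filter.Tendsto (fun t => baseProjL n (graphCurve u p w t))
      (Filter.cocompact ℝ) (Filter.cocompact (Euc n)) := by
    simpa only [baseProjL_graphCurve] using hline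
  have hcomap := Filter.tendsto_iff_comap.1 h
  rw [Filter.tendsto_iff_comap]
  refine hcomap.trans ?_
  rw [← Function.comp_def, ← Filter.comap_comap]
  exact Filter.comap_mono (Filter.comap_cocompact_le (baseProjL n).continuous)

section Leaf

variable {n : ℕ} {F : Foliation n} {N : Euc (n + 1) → Euc (n + 1)} {u : Euc n → ℝ}

theorem deriv_graphCurve_mem_tangentVectors (hu : ContDiff ℝ ∞ u) (p w : Euc (n + 1)) (t : ℝ) :
    w + deriv (graphHeight u p w) t • vertical n ∈
      tangentVectors {q : Euc (n + 1) | q (Fin.last n) = u (baseProj q)} (graphCurve u p w t) := by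
  refine ⟨fun s => graphCurve u p w (s + t), ?_, by simp, ?_,
    Filter.Eventually.of_forall fun s => graphCurve_mem u p w (s + t)⟩
  · exact ((contDiff_graphCurve hu p w).comp (contDiff_id.add contDiff_const)).contDiffAt
  · rw [deriv_comp_add_const, zero_add]
    exact (hasDerivAt_graphCurve hu p w t).deriv

theorem inner_normal_graphCurve (hN : IsUpwardUnitNormal F N) (hu : ContDiff ℝ ∞ u)
    (hL : {q : Euc (n + 1) | q (Fin.last n) = u (baseProj q)} ∈ F.leaves) (p w : Euc (n + 1))
    (t : ℝ) :
    ⟪N (graphCurve u p w t), w + deriv (graphHeight u p w) t • vertical n⟫ = 0 :=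
  hN.normal _ hL _ (graphCurve_mem u p w t) _ (deriv_graphCurve_mem_tangentVectors hu p w t)

theorem deriv_graphHeight (hN : IsUpwardUnitNormal F N) (hu : ContDiff ℝ ∞ u)
    (hL : {q : Euc (n + 1) | q (Fin.last n) = u (baseProj q)} ∈ F.leaves) (p w : Euc (n + 1))
    (t : ℝ) :
    deriv (graphHeight u p w) t =
      -⟪N (graphCurve u p w t), w⟫ / N (graphCurve u p w t) (Fin.last n) := by
  have h := inner_normal_graphCurve hN hu hL p w t
  have hpos := hN.upward (graphCurve u p w t)
  rw [inner_add_right, inner_smul_right, inner_vertical] at h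
  rw [eq_div_iff hpos.ne']
  linarith

/-- Differentiating `⟪N, γ'⟫ = 0` along the lifted curve gives `h'' * N_last = ⟪A γ', γ'⟫ ≥ 0`, with
`N_last > 0`. -/
theorem monotone_deriv_graphHeight (hN : IsUpwardUnitNormal F N)
    (hA : NonnegSecondFundamentalForm F N) (hu : ContDiff ℝ ∞ u)
    (hL : {q : Euc (n + 1) | q (Fin.last n) = u (baseProj q)} ∈ F.leaves) (p w : Euc (n + 1)) :
    Monotone (deriv (graphHeight u p w)) := by
  have hd : Differentiable ℝ (deriv (graphHeight u p w)) :=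
    ((contDiff_infty_iff_deriv.1 (contDiff_graphHeight hu p w)).2).differentiable (by simp)
  refine monotone_of_deriv_nonneg hd fun t => ?_
  have hNc : HasDerivAt (fun s => N (graphCurve u p w s))
      (fderiv ℝ N (graphCurve u p w t) (w + deriv (graphHeight u p w) t • vertical n)) t :=
    (hN.smooth.differentiable (by simp) _).hasFDerivAt.comp_hasDerivAt t
      (hasDerivAt_graphCurve hu p w t)
  have hvel : HasDerivAt (fun s => w + deriv (graphHeight u p w) s • vertical n)
      (deriv (deriv (graphHeight u p w)) t • vertical n) t :=
    ((hd t).hasDerivAt.smul_const (vertical n)).const_add w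
  have hinner := hNc.inner ℝ hvel
  simp only [inner_normal_graphCurve hN hu hL p w] at hinner
  have hzero := hinner.unique (hasDerivAt_const t (0 : ℝ))
  have hnonneg := hA _ hL _ (graphCurve_mem u p w t) _
    (deriv_graphCurve_mem_tangentVectors hu p w t)
  rw [shapeOperator, neg_apply, inner_neg_left] at hnonneg
  rw [inner_smul_right, inner_vertical] at hzero
  refine nonneg_of_mul_nonneg_left ?_ (hN.upward (graphCurve u p w t))
  linarith

end Leaf

theorem ConvergesAtInfinity.ne_zero {n : ℕ} {N : Euc (n + 1) → Euc (n + 1)} {ξ : Euc (n + 1)}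
    (hξ : ConvergesAtInfinity N ξ) : ξ ≠ 0 := by
  rintro rfl
  unfold ConvergesAtInfinity at hξ
  -- By convention the angle with the zero vector is `π / 2`.
  simp only [InnerProductGeometry.angle_zero_right] at hξ
  have := tendsto_nhds_unique hξ tendsto_const_nhds
  linarith [Real.pi_pos]

/-- Unit vectors whose angle with `ξ` tends to `0` converge to the normalization of `ξ`. -/
theorem ConvergesAtInfinity.tendsto {n : ℕ} {N : Euc (n + 1) → Euc (n + 1)} {ξ : Euc (n + 1)}
    (hξ : ConvergesAtInfinity N ξ) (hN : ∀ p, ‖N p‖ = 1) :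
    Filter.Tendsto N (Filter.cocompact (Euc (n + 1))) (𝓝 (‖ξ‖⁻¹ • ξ)) := by
  have hpos : 0 < ‖ξ‖ := norm_pos_iff.2 hξ.ne_zero
  rw [tendsto_iff_norm_sub_tendsto_zero]
  have hcos := (Real.continuous_cos.tendsto 0).comp hξ
  -- For unit vectors at angle `θ`, the distance is `√(2 - 2 cos θ)`.
  have hsqrt : Filter.Tendsto
      (fun p => √(2 - 2 * Real.cos (InnerProductGeometry.angle (N p) ξ)))
      (Filter.cocompact (Euc (n + 1))) (𝓝 √(2 - 2 * Real.cos 0)) :=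
    (tendsto_const_nhds.sub (hcos.const_mul 2)).sqrt
  simp only [Real.cos_zero, mul_one, sub_self, Real.sqrt_zero] at hsqrt
  refine hsqrt.congr fun p => ?_
  have hle := Real.cos_le_one (InnerProductGeometry.angle (N p) ξ)
  rw [Real.sqrt_eq_iff_mul_self_eq (by linarith) (norm_nonneg _), ← pow_two, norm_sub_sq_real, hN, inner_smul_right, norm_smul, norm_inv,
    norm_norm, inv_mul_cancel₀ hpos.ne', InnerProductGeometry.cos_angle, hN]
  field_simp
  ring

theorem Monotone.eq_of_tendsto_atBot_atTop {f : ℝ → ℝ} (hf : Monotone f) {a : ℝ}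
    (hbot : Filter.Tendsto f Filter.atBot (𝓝 a)) (htop : Filter.Tendsto f Filter.atTop (𝓝 a))
    (t : ℝ) : f t = a :=
  le_antisymm (hf.ge_of_tendsto htop t) (hf.le_of_tendsto hbot t)

section Leaf

variable {n : ℕ} {F : Foliation n} {N : Euc (n + 1) → Euc (n + 1)} {u : Euc n → ℝ}
  {ξ : Euc (n + 1)}

/-- The limit of the normals cannot be horizontal. -/
theorem last_limit_normal_ne_zero (hN : IsUpwardUnitNormal F N)
    (hA : NonnegSecondFundamentalForm F N) (hξ : ConvergesAtInfinity N ξ) (hu : ContDiff ℝ ∞ u)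
    (hL : {q : Euc (n + 1) | q (Fin.last n) = u (baseProj q)} ∈ F.leaves) :
    ξ (Fin.last n) ≠ 0 := by
  intro h0
  have hbase : baseProjL n ξ ≠ 0 := fun hb =>
    hξ.ne_zero (eq_of_baseProjL_eq_of_last_eq (by simpa using hb) (by simpa using h0))
  have hpos : 0 < ‖ξ‖ := norm_pos_iff.2 hξ.ne_zero
  have hlim : Filter.Tendsto (fun t => N (graphCurve u 0 ξ t)) Filter.atTop (𝓝 (‖ξ‖⁻¹ • ξ)) :=
    (hξ.tendsto hN.norm_eq_one).comp
      ((tendsto_graphCurve_cocompact u 0 hbase).mono_left atTop_le_cocompact)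
  have hinner : Filter.Tendsto (fun t => ⟪N (graphCurve u 0 ξ t), ξ⟫) Filter.atTop (𝓝 ‖ξ‖) := by
    have h := hlim.inner (𝕜 := ℝ) (tendsto_const_nhds (x := ξ))
    rwa [real_inner_smul_left, real_inner_self_eq_norm_sq, pow_two,
      inv_mul_cancel_left₀ hpos.ne'] at h
  have hlast : Filter.Tendsto (fun t => N (graphCurve u 0 ξ t) (Fin.last n)) Filter.atTop
      (𝓝 0) := by
    have h := hlim.inner (𝕜 := ℝ) (tendsto_const_nhds (x := vertical n))
    simpa only [real_inner_smul_left, inner_vertical, h0, mul_zero] using h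
  have hbound : Filter.Tendsto (fun t => -(deriv (graphHeight u 0 ξ) 0) *
      N (graphCurve u 0 ξ t) (Fin.last n)) Filter.atTop (𝓝 0) := by
    simpa using hlast.const_mul (-(deriv (graphHeight u 0 ξ) 0))
  -- Lifting in the direction `ξ` itself, monotonicity of the slope gives `⟪N, ξ⟫ ≤ -h'(0) * N_last`
  -- for `t ≥ 0`; in the limit, `‖ξ‖ ≤ 0`.
  refine hpos.not_ge (le_of_tendsto_of_tendsto hinner hbound ?_)
  filter_upwards [Filter.eventually_ge_atTop 0] with t ht
  have hm := monotone_deriv_graphHeight hN hA hu hL 0 ξ ht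
  rw [deriv_graphHeight hN hu hL 0 ξ t, le_div_iff₀ (hN.upward _)] at hm
  linarith

theorem inner_eq_of_mem_leaf (hN : IsUpwardUnitNormal F N)
    (hA : NonnegSecondFundamentalForm F N) (hξ : ConvergesAtInfinity N ξ) (hu : ContDiff ℝ ∞ u)
    (hL : {q : Euc (n + 1) | q (Fin.last n) = u (baseProj q)} ∈ F.leaves) {p q : Euc (n + 1)}
    (hp : p (Fin.last n) = u (baseProj p)) (hq : q (Fin.last n) = u (baseProj q)) :
    ⟪ξ, q⟫ = ⟪ξ, p⟫ := by
  -- Over a vertical direction the lifted curve does not escape to infinity, but then `p = q`, both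
  -- being on one graph.
  by_cases hw : baseProjL n (q - p) = 0
  · have hb : baseProjL n q = baseProjL n p := by rwa [map_sub, sub_eq_zero] at hw
    rw [eq_of_baseProjL_eq_of_last_eq hb (by rw [hp, hq]; exact congrArg u hb)]
  have h0 := last_limit_normal_ne_zero hN hA hξ hu hL
  have hnorm : ‖ξ‖ ≠ 0 := norm_ne_zero_iff.2 hξ.ne_zero
  have hlim : Filter.Tendsto (fun t => N (graphCurve u p (q - p) t)) (Filter.cocompact ℝ)
      (𝓝 (‖ξ‖⁻¹ • ξ)) :=
    (hξ.tendsto hN.norm_eq_one).comp (tendsto_graphCurve_cocompact u p hw)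
  have hslope : Filter.Tendsto (deriv (graphHeight u p (q - p))) (Filter.cocompact ℝ)
      (𝓝 (-⟪ξ, q - p⟫ / ξ (Fin.last n))) := by
    have hnum := (hlim.inner (𝕜 := ℝ) (tendsto_const_nhds (x := q - p))).neg
    have hden := hlim.inner (𝕜 := ℝ) (tendsto_const_nhds (x := vertical n))
    have h := hnum.div hden (by
      rw [real_inner_smul_left, inner_vertical]
      exact mul_ne_zero (inv_ne_zero hnorm) h0)
    rw [real_inner_smul_left, real_inner_smul_left, inner_vertical, ← mul_neg,
      mul_div_mul_left _ _ (inv_ne_zero hnorm)] at h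
    refine h.congr fun t => ?_
    rw [deriv_graphHeight hN hu hL]
    simp only [Pi.div_apply, inner_vertical]
  have hconst := (monotone_deriv_graphHeight hN hA hu hL p (q - p)).eq_of_tendsto_atBot_atTop
    (hslope.mono_left atBot_le_cocompact) (hslope.mono_left atTop_le_cocompact)
  have hderiv : ∀ t, HasDerivAt (fun s => ⟪ξ, graphCurve u p (q - p) s⟫) 0 t := by
    intro t
    have h := (hasDerivAt_const t ξ).inner ℝ (hasDerivAt_graphCurve hu p (q - p) t)
    rwa [hconst t, inner_add_right, inner_smul_right, inner_vertical, div_mul_cancel₀ _ h0,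
      add_neg_cancel, inner_zero_left, add_zero] at h
  have h := is_const_of_deriv_eq_zero (fun t => (hderiv t).differentiableAt)
    (fun t => (hderiv t).deriv) 1 0
  simpa only [graphCurve_sub_one p hq, graphCurve_zero hp] using h

end Leaf

theorem corollary4p4 (n : ℕ) (F : Foliation n)
    (hgraph : ∀ L ∈ F.leaves, IsEntireGraph L)
    (N : Euc (n + 1) → Euc (n + 1)) (hN : IsUpwardUnitNormal F N)
    (hA : NonnegSecondFundamentalForm F N)
    (ξ : Euc (n + 1)) (hξ : ConvergesAtInfinity N ξ) :
    ∀ L ∈ F.leaves, IsHyperplaneOrthogonalTo L ξ := by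
  intro L hL
  obtain ⟨u, hu, rfl⟩ := hgraph L hL
  have h0 := last_limit_normal_ne_zero hN hA hξ hu hL
  obtain ⟨p, hp⟩ : Set.Nonempty {q : Euc (n + 1) | q (Fin.last n) = u (baseProj q)} :=
    ⟨_, graphCurve_mem u 0 0 0⟩
  refine ⟨hξ.ne_zero, ⟪ξ, p⟫, Set.Subset.antisymm
    (fun q hq => inner_eq_of_mem_leaf hN hA hξ hu hL hp hq) fun q hq => ?_⟩
  -- Move `q` vertically onto the leaf: the value of `⟪ξ, ·⟫` does not change, so the displacement
  -- vanishes because `ξ` is not horizontal.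
  have hmem := graphCurve_mem u q 0 0
  have h := inner_eq_of_mem_leaf hN hA hξ hu hL hp hmem
  have hheight : graphHeight u q 0 0 * ξ (Fin.last n) = 0 := by
    rw [← (show ⟪ξ, q⟫ = ⟪ξ, p⟫ from hq), graphCurve, inner_add_right, inner_smul_right,
      inner_vertical, smul_zero, add_zero] at h
    linarith
  have hzero := (mul_eq_zero.1 hheight).resolve_right h0
  simp only [graphHeight, smul_zero, add_zero, baseProjL_apply] at hzero
  exact (sub_eq_zero.1 hzero).symm
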